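/- Let $H, K$ be complex Hilbert spaces, write $x\circ y=\frac12(xy+yx)$, and let $T:A\to B(H)$ be a linear contraction (norm $\le 1$) on a linear subspace $A\subseteq B(K)$, where either (i) $A$ is a unital operator space, that is, $A$ contains the identity operator $1_K$, and $T$ is unital: $T(1_K)=1_H$; or (ii) $A$ is an approximately unital Jordan operator algebra, that is, $A$ is norm closed, $x\circ y\in A$ for all $x,y\in A$, and there is a net $(e_t)$ in $A$ with $\|e_t\|\le 1$ and $\|e_t\circ a-a\|\to 0$ for all $a\in A$; and $T$ is real positive, that is, for $a\in A$, $a+a^*\ge 0$ implies $T(a)+T(a)^*\ge 0$. Suppose that $e\in A$ is a projection ($e=e^*=e^2$) with $e\circ A\subseteq A$, such that $q=T(e)$ is a projection in $B(H)$. Then $eae\in A$ and $a \circ e\in A$, and $$T(eae)=q\,T(a)\,q \qquad\text{and}\qquad T(a\circ e)=T(a)\circ q$$ for all $a\in A$. -/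

import Mathlib

open Filter Topology

noncomputable section

/-- The Jordan product `x ∘ y = (xy + yx) / 2`. -/
def jordanProd {R : Type*} [Ring R] [Algebra ℂ R] (x y : R) : R :=
  (1 / 2 : ℂ) • (x * y + y * x)

section

variable {K : Type*} [NormedAddCommGroup K] [InnerProductSpace ℂ K] [CompleteSpace K]
variable {H : Type*} [NormedAddCommGroup H] [InnerProductSpace ℂ H] [CompleteSpace H]

/-- A bounded operator `x` is real positive (accretive) if `Re x = (x + x*) / 2 ≥ 0`. -/
def IsRealPositive (x : K →L[ℂ] K) : Prop :=
  ((1 / 2 : ℂ) • (x + ContinuousLinearMap.adjoint x)).IsPositive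

/-- A Jordan operator algebra on `K`: a norm closed linear subspace of `B(K)` that is closed
under the Jordan product. -/
structure IsJordanOperatorAlgebra (A : Submodule ℂ (K →L[ℂ] K)) : Prop where
  isClosed : IsClosed (A : Set (K →L[ℂ] K))
  jordanProd_mem : ∀ x ∈ A, ∀ y ∈ A, jordanProd x y ∈ A

/-- `A` has a Jordan contractive approximate identity: a net of contractions `u` in `A` with
`u ∘ a → a` in norm for every `a` in `A`. The net is given, as is usual in Mathlib, by a proper
filter on `A`. -/
def HasJordanCai (A : Submodule ℂ (K →L[ℂ] K)) : Prop :=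
  ∃ l : Filter A, l.NeBot ∧ (∀ᶠ u in l, ‖u‖ ≤ 1) ∧
    ∀ a ∈ A, Tendsto (fun u : A => jordanProd (u : K →L[ℂ] K) a) l (𝓝 a)

/-- An approximately unital Jordan operator algebra on `K`. -/
structure IsApproxUnitalJordanOperatorAlgebra (A : Submodule ℂ (K →L[ℂ] K)) : Prop
    extends IsJordanOperatorAlgebra A where
  hasJordanCai : HasJordanCai A

/-- `A` is a unital operator space in `B(K)`, that is, it contains the identity operator of `K`,
and `T` maps this identity to the identity operator of `H`. -/
def IsUnitalMap (A : Submodule ℂ (K →L[ℂ] K)) (T : A →ₗ[ℂ] (H →L[ℂ] H)) : Prop :=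
  ∃ h : (1 : K →L[ℂ] K) ∈ A, T ⟨1, h⟩ = 1

/-- `T` maps real positive elements of `A` to real positive operators. -/
def IsRealPositiveMap (A : Submodule ℂ (K →L[ℂ] K)) (T : A →ₗ[ℂ] (H →L[ℂ] H)) : Prop :=
  ∀ a : A, IsRealPositive (a : K →L[ℂ] K) → IsRealPositive (T a)

/-- `T` has norm at most one. -/
def IsContractiveMap (A : Submodule ℂ (K →L[ℂ] K)) (T : A →ₗ[ℂ] (H →L[ℂ] H)) : Prop :=
  ∀ a : A, ‖T a‖ ≤ ‖a‖

end

end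

/-! Split `a = x + b + d` into Peirce pieces: `x = eae`, `b = ea(1-e) + (1-e)ae`, `d = (1-e)a(1-e)`.
All three lie in `A`, since `eae` is built from Jordan products with `e`. It suffices that `T` sends
each piece into the matching Peirce part for `q`.

Perturbing `e` by small multiples of a piece and comparing orders gives this. If `ebe = 0`, then `‖e
+ cb‖` exceeds 1 only by `O(|c|²)`, so contractivity kills the `q`-corner of `T b`. If `ed = de =
0`, then `‖e + td‖ ≤ 1` for small `t`, and a contraction `q + tT(d)` with zero `q`-corner forces `q
T(d) = T(d) q = 0`. The corner at `1 - q` needs positivity: when `(1-e)b(1-e) = 0`, a multiple of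
`e` plus `cb` has real part at least `-O(|c|²)`. For `x`, accretivity of `‖x‖e + λx` for all
unimodular `λ` also removes the off-diagonal part of `T x`.

Hence `T` must preserve approximate lower bounds on real parts (`rePartGE_map`). For unital maps,
add a multiple of 1; in the Jordan case, almost accretive elements are corrected inside `A` with an
approximate identity (`exists_accretive`). -/

section AlmostUnit

/-! ### Real parts and perturbation by an almost unit. -/

variable {K : Type*} [NormedAddCommGroup K] [InnerProductSpace ℂ K]

/-- The real part of `x` is at least `c`, in the sense of quadratic forms. -/
def RePartGE (x : K →L[ℂ] K) (c : ℝ) : Prop :=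
  ∀ ξ : K, c * ‖ξ‖ ^ 2 ≤ (inner ℂ (x ξ) ξ).re

theorem isRealPositive_iff [CompleteSpace K] (x : K →L[ℂ] K) :
    IsRealPositive x ↔ RePartGE x 0 := by
  unfold IsRealPositive RePartGE
  have key : ∀ ξ : K, ((1 / 2 : ℂ) • (x + ContinuousLinearMap.adjoint x)).reApplyInnerSelf ξ
      = (inner ℂ (x ξ) ξ).re := by
    intro ξ
    have h1 : (inner ℂ ξ (x ξ)).re = (inner ℂ (x ξ) ξ).re := by
      rw [← inner_conj_symm, Complex.conj_re]
    simp [ContinuousLinearMap.reApplyInnerSelf, inner_smul_left, inner_add_left,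
      ContinuousLinearMap.adjoint_inner_left, h1]
    ring
  rw [ContinuousLinearMap.isPositive_def]
  constructor
  · rintro ⟨_, h⟩ ξ
    rw [zero_mul, ← key]; exact h ξ
  · intro h
    refine ⟨?_, fun ξ => ?_⟩
    · rw [← ContinuousLinearMap.isSelfAdjoint_iff_isSymmetric, ← ContinuousLinearMap.star_eq_adjoint]
      exact IsSelfAdjoint.smul (by simp [IsSelfAdjoint]) (IsSelfAdjoint.add_star_self x)
    · rw [key]; simpa using h ξ

theorem two_smul_jordanProd {R : Type*} [Ring R] [Algebra ℂ R] (x y : R) :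
    (2 : ℂ) • jordanProd x y = x * y + y * x := by
  simp [jordanProd, smul_smul]

/-! ### From Jordan approximate identities to two-sided ones. -/

section ApproximateIdentity

variable {R : Type*} [NormedRing R] [NormedAlgebra ℂ R] {ι : Type*} {l : Filter ι} {u : ι → R}

/-- The commutator of `u ∘ a` with `a` is half the commutator of `u` with `a²`. It tends to `[a, a]
= 0`, so `u a²` and `a² u` have the same limit as their mean `u ∘ a²`. -/
theorem tendsto_mul_sq_of_jordan {a : R}
    (h1 : Tendsto (fun i => jordanProd (u i) a) l (𝓝 a))
    (h2 : Tendsto (fun i => jordanProd (u i) (a * a)) l (𝓝 (a * a))) :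
    Tendsto (fun i => u i * (a * a)) l (𝓝 (a * a)) ∧
      Tendsto (fun i => (a * a) * u i) l (𝓝 (a * a)) := by
  have h3 : Tendsto (fun i => jordanProd (u i) a * a - a * jordanProd (u i) a) l
      (𝓝 (a * a - a * a)) := (h1.mul_const a).sub (h1.const_mul a)
  have e3 : ∀ i, jordanProd (u i) a * a - a * jordanProd (u i) a
      = (1 / 2 : ℂ) • (u i * (a * a) - a * a * u i) := by
    intro i
    simp only [jordanProd, smul_mul_assoc, mul_smul_comm, ← smul_sub]
    congr 1; noncomm_ring
  constructor
  · have := h2.add h3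
    simp only [sub_self, add_zero] at this
    refine this.congr fun i => ?_
    rw [e3, jordanProd, ← smul_add]
    rw [show u i * (a * a) + a * a * u i + (u i * (a * a) - a * a * u i)
      = (2 : ℂ) • (u i * (a * a)) by rw [two_smul]; abel, smul_smul]
    norm_num
  · have := h2.sub h3
    simp only [sub_self, sub_zero] at this
    refine this.congr fun i => ?_
    rw [e3, jordanProd, ← smul_sub]
    rw [show u i * (a * a) + a * a * u i - (u i * (a * a) - a * a * u i)
      = (2 : ℂ) • (a * a * u i) by rw [two_smul]; abel, smul_smul]
    norm_num

/-- A contractive approximate identity for the Jordan product is one for the product. -/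
theorem tendsto_mul_of_jordan [l.NeBot] {A : Submodule ℂ R}
    (hJ : ∀ x ∈ A, ∀ y ∈ A, jordanProd x y ∈ A)
    (huA : ∀ i, u i ∈ A) (hu : ∀ᶠ i in l, ‖u i‖ ≤ 1)
    (h : ∀ a ∈ A, Tendsto (fun i => jordanProd (u i) a) l (𝓝 a)) {a : R} (ha : a ∈ A) :
    Tendsto (fun i => u i * a) l (𝓝 a) ∧ Tendsto (fun i => a * u i) l (𝓝 a) := by
  have sq : ∀ x ∈ A, x * x ∈ A := by
    intro x hx
    have := hJ x hx x hx
    rw [jordanProd, ← two_smul ℂ, smul_smul] at this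
    simpa using this
  have hsq : ∀ x ∈ A, Tendsto (fun i => u i * (x * x)) l (𝓝 (x * x)) ∧
      Tendsto (fun i => (x * x) * u i) l (𝓝 (x * x)) := fun x hx =>
    tendsto_mul_sq_of_jordan (h x hx) (h _ (sq x hx))
  have pol : ∀ x y : R, jordanProd x y
      = (1 / 2 : ℂ) • ((x + y) * (x + y) - x * x - y * y) := by
    intro x y; rw [jordanProd]; congr 1; noncomm_ring
  have hjp : ∀ x ∈ A, ∀ y ∈ A,
      Tendsto (fun i => u i * jordanProd x y) l (𝓝 (jordanProd x y)) ∧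
      Tendsto (fun i => jordanProd x y * u i) l (𝓝 (jordanProd x y)) := by
    intro x hx y hy
    have h1 := hsq _ (A.add_mem hx hy)
    have h2 := hsq x hx
    have h3 := hsq y hy
    rw [pol]
    constructor
    · refine (((h1.1.sub h2.1).sub h3.1).const_smul (1 / 2 : ℂ)).congr fun i => ?_
      rw [mul_smul_comm, mul_sub, mul_sub]
    · refine (((h1.2.sub h2.2).sub h3.2).const_smul (1 / 2 : ℂ)).congr fun i => ?_
      rw [smul_mul_assoc, sub_mul, sub_mul]
  -- Squares give Jordan products by polarization. Those of the form `w ∘ a` approximate `a`, and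
  -- the bound on `u` transfers the limit to `a`.
  have approx : ∀ ε > 0, ∃ w ∈ A, ‖jordanProd w a - a‖ < ε := by
    intro ε hε
    obtain ⟨i, hi⟩ := (Metric.tendsto_nhds.1 (h a ha) ε hε).exists
    exact ⟨u i, huA i, by rwa [dist_eq_norm] at hi⟩
  constructor
  all_goals
    rw [Metric.tendsto_nhds]
    intro ε hε
    obtain ⟨w, hw, hwa⟩ := approx (ε / 3) (by positivity)
    set c := jordanProd w a with hc
  · filter_upwards [hu, Metric.tendsto_nhds.1 (hjp w hw a ha).1 (ε / 3) (by positivity)]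
      with i hi1 hi2
    rw [dist_eq_norm] at hi2 ⊢
    have e : u i * a - a = -(u i * (c - a)) + (u i * c - c) + (c - a) := by noncomm_ring
    have n1 : ‖u i * (c - a)‖ ≤ ‖c - a‖ :=
      (norm_mul_le _ _).trans (mul_le_of_le_one_left (norm_nonneg _) hi1)
    rw [e]
    calc _ ≤ ‖u i * (c - a)‖ + ‖u i * c - c‖ + ‖c - a‖ := by
          refine norm_add₃_le.trans ?_; rw [norm_neg]
      _ < ε := by linarith
  · filter_upwards [hu, Metric.tendsto_nhds.1 (hjp w hw a ha).2 (ε / 3) (by positivity)]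
      with i hi1 hi2
    rw [dist_eq_norm] at hi2 ⊢
    have e : a * u i - a = -((c - a) * u i) + (c * u i - c) + (c - a) := by noncomm_ring
    have n1 : ‖(c - a) * u i‖ ≤ ‖c - a‖ :=
      (norm_mul_le _ _).trans (mul_le_of_le_one_right (norm_nonneg _) hi1)
    rw [e]
    calc _ ≤ ‖(c - a) * u i‖ + ‖c * u i - c‖ + ‖c - a‖ := by
          refine norm_add₃_le.trans ?_; rw [norm_neg]
      _ < ε := by linarith

end ApproximateIdentity

/-- If a contraction `f` almost fixes a vector `w`, then so does its adjoint. -/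
theorem norm_sq_adjoint_sub_le [CompleteSpace K] {f : K →L[ℂ] K} (hf : ‖f‖ ≤ 1) (w : K) :
    ‖ContinuousLinearMap.adjoint f w - w‖ ^ 2 ≤ 2 * (‖f w - w‖ * ‖w‖) := by
  have h1 : ‖ContinuousLinearMap.adjoint f w‖ ≤ ‖w‖ := by
    refine (ContinuousLinearMap.le_opNorm _ _).trans ?_
    rw [LinearIsometryEquiv.norm_map]
    exact mul_le_of_le_one_left (norm_nonneg _) hf
  have h2 := @norm_sub_sq ℂ _ _ _ _ (ContinuousLinearMap.adjoint f w) w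
  rw [ContinuousLinearMap.adjoint_inner_left] at h2
  have h3 : ‖w‖ ^ 2 - RCLike.re (inner ℂ w (f w)) ≤ ‖f w - w‖ * ‖w‖ := by
    have := abs_le.1 ((Complex.abs_re_le_norm _).trans (norm_inner_le_norm (𝕜 := ℂ) w (f w - w)))
    rw [inner_sub_right, Complex.sub_re] at this
    have e : (inner ℂ w w).re = ‖w‖ ^ 2 := by
      simpa using inner_self_eq_norm_sq (𝕜 := ℂ) w
    rw [e] at this
    have := this.1
    simp only [RCLike.re_to_complex]
    linarith
  nlinarith [norm_nonneg (ContinuousLinearMap.adjoint f w)]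

/-- Test `y` on the midpoint `g` of `ξ` and `f ξ`. As `y f` and `f* y` are close to `y`, the form of
`y` at `g` is within `ε/4 ‖ξ‖²` of that at `ξ`, while `‖g‖²` is at most half of `‖ξ‖² + Re ⟨f ξ,
ξ⟩`. The second half is absorbed by `(ε/2) f`, leaving `ε/2 + ε/4`. -/
theorem RePartGE.add_smul_of_almost_unit {y f : K →L[ℂ] K} {ε : ℝ} (hε : 0 < ε)
    (hy : RePartGE y (-ε)) (hf : ‖f‖ ≤ 1) (h1 : ‖y * f - y‖ ≤ ε / 4)
    (h2 : ∀ ξ : K, ‖inner ℂ (y ξ) (f ξ - ξ)‖ ≤ ε / 4 * ‖ξ‖ ^ 2) :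
    RePartGE (y + ((ε / 2 : ℝ) : ℂ) • f) (-(3 / 4 * ε)) := by
  intro ξ
  have hfξ : ‖f ξ‖ ≤ ‖ξ‖ :=
    (f.le_opNorm ξ).trans (mul_le_of_le_one_left (norm_nonneg _) hf)
  set g : K := (1 / 2 : ℂ) • (ξ + f ξ) with hg
  have hgn : ‖g‖ ^ 2 ≤ 1 / 2 * ‖ξ‖ ^ 2 + 1 / 2 * (inner ℂ (f ξ) ξ).re := by
    have e := @norm_add_sq ℂ _ _ _ _ (f ξ) ξ
    rw [hg, norm_smul, mul_pow, add_comm ξ, e]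
    simp only [RCLike.re_to_complex]
    norm_num
    nlinarith [norm_nonneg (f ξ)]
  have hgξ : ‖g‖ ≤ ‖ξ‖ := by
    rw [hg, norm_smul]
    have := norm_add_le ξ (f ξ)
    norm_num
    linarith
  have e1 : inner ℂ (y g) g = inner ℂ (y ξ) ξ + (1 / 2 : ℂ) * inner ℂ ((y * f - y) ξ) g
      + (1 / 2 : ℂ) * inner ℂ (y ξ) (f ξ - ξ) := by
    have e2 : y g = y ξ + (1 / 2 : ℂ) • (y * f - y) ξ := by
      simp [hg, smul_sub]
      module
    have e3 : inner ℂ (y ξ) g = inner ℂ (y ξ) ξ + (1 / 2 : ℂ) * inner ℂ (y ξ) (f ξ - ξ) := by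
      rw [← inner_smul_right, ← inner_add_right]
      congr 1; rw [hg]; module
    have hc : starRingEnd ℂ (1 / 2 : ℂ) = 1 / 2 := by
      rw [map_div₀, map_one, Complex.conj_ofNat]
    rw [e2, inner_add_left, inner_smul_left, e3, hc]
    ring
  have b1 : ‖inner ℂ ((y * f - y) ξ) g‖ ≤ ε / 4 * ‖ξ‖ ^ 2 := by
    refine (norm_inner_le_norm _ _).trans ?_
    have := (y * f - y).le_opNorm ξ
    calc _ ≤ (ε / 4 * ‖ξ‖) * ‖ξ‖ := by
          gcongr
          exact this.trans (by gcongr)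
      _ = _ := by ring
  have b2 := h2 ξ
  have hyg := hy g
  have e1r := congrArg Complex.re e1
  have r1 := (Complex.abs_re_le_norm _).trans b1
  have r2 := (Complex.abs_re_le_norm _).trans b2
  have half : ∀ z : ℂ, ((1 / 2 : ℂ) * z).re = 1 / 2 * z.re := by
    intro z; simp
  rw [Complex.add_re, Complex.add_re, half, half] at e1r
  rw [abs_le] at r1 r2
  have goal_e : (inner ℂ ((y + ((ε / 2 : ℝ) : ℂ) • f) ξ) ξ).re
      = (inner ℂ (y ξ) ξ).re + ε / 2 * (inner ℂ (f ξ) ξ).re := by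
    rw [add_apply, inner_add_left, smul_apply,
      inner_smul_left, Complex.conj_ofReal, Complex.add_re, Complex.re_ofReal_mul]
  rw [goal_e]
  nlinarith

end AlmostUnit

/-! ### Stability of lower bounds; unital contractions. -/

section QuadraticForm

variable {K : Type*} [NormedAddCommGroup K] [InnerProductSpace ℂ K]

theorem RePartGE.mono {x : K →L[ℂ] K} {c d : ℝ} (h : RePartGE x c) (hdc : d ≤ c) :
    RePartGE x d := fun ξ => (mul_le_mul_of_nonneg_right hdc (sq_nonneg _)).trans (h ξ)

theorem RePartGE.of_forall_add {x : K →L[ℂ] K} {c d : ℝ}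
    (h : ∀ δ > 0, RePartGE x (c - d * δ)) : RePartGE x c := by
  intro ξ
  have ht : Tendsto (fun δ : ℝ => (c - d * δ) * ‖ξ‖ ^ 2) (𝓝[>] 0) (𝓝 ((c - d * 0) * ‖ξ‖ ^ 2)) :=
    (Continuous.tendsto (by fun_prop) 0).mono_left nhdsWithin_le_nhds
  rw [mul_zero, sub_zero] at ht
  exact le_of_tendsto ht (eventually_nhdsWithin_of_forall fun δ hδ => h δ hδ ξ)

theorem RePartGE.of_tendsto {x : K →L[ℂ] K} {y : ℕ → K →L[ℂ] K} {c : ℕ → ℝ} {d : ℝ}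
    (hy : Tendsto y atTop (𝓝 x)) (hc : Tendsto c atTop (𝓝 d)) (h : ∀ n, RePartGE (y n) (c n)) :
    RePartGE x d := by
  intro ξ
  have hcont : Continuous fun z : K →L[ℂ] K => (inner ℂ (z ξ) ξ).re := by fun_prop
  exact le_of_tendsto_of_tendsto (hc.mul_const _) ((hcont.tendsto x).comp hy)
    (Eventually.of_forall fun n => h n ξ)

theorem RePartGE.of_norm_sub_le {x y : K →L[ℂ] K} {c d : ℝ} (hx : RePartGE x c)
    (h : ‖x - y‖ ≤ d) : RePartGE y (c - d) := by
  intro ξ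
  have h1 : ‖inner ℂ ((x - y) ξ) ξ‖ ≤ d * ‖ξ‖ ^ 2 := by
    refine (norm_inner_le_norm _ _).trans ?_
    rw [sq, ← mul_assoc]
    gcongr
    exact (x - y).le_of_opNorm_le h ξ
  have h2 := (abs_le.1 ((Complex.abs_re_le_norm _).trans h1)).2
  rw [sub_apply, inner_sub_left, Complex.sub_re] at h2
  have := hx ξ
  linarith

theorem norm_sq_one_sub_smul_apply (x : K →L[ℂ] K) (t : ℝ) (η : K) :
    ‖((1 : K →L[ℂ] K) - (t : ℂ) • x) η‖ ^ 2
      = ‖η‖ ^ 2 - 2 * (t * (inner ℂ (x η) η).re) + t ^ 2 * ‖x η‖ ^ 2 := by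
  rw [sub_apply, smul_apply, one_apply_eq_self, @norm_sub_rev, @norm_sub_sq ℂ,
    inner_smul_left, Complex.conj_ofReal, norm_smul, Complex.norm_real, mul_pow, Real.norm_eq_abs,
    sq_abs]
  simp only [RCLike.re_to_complex, Complex.re_ofReal_mul]
  ring

theorem re_inner_add_smul_one_apply (x : K →L[ℂ] K) (ε : ℝ) (η : K) :
    (inner ℂ ((x + (ε : ℂ) • (1 : K →L[ℂ] K)) η) η).re
      = (inner ℂ (x η) η).re + ε * ‖η‖ ^ 2 := by
  have e : (inner ℂ η η).re = ‖η‖ ^ 2 := by simpa using inner_self_eq_norm_sq (𝕜 := ℂ) η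
  rw [add_apply, smul_apply, one_apply_eq_self, inner_add_left, inner_smul_left,
    Complex.conj_ofReal, Complex.add_re, Complex.re_ofReal_mul, e]

variable {H : Type*} [NormedAddCommGroup H] [InnerProductSpace ℂ H]

/-- A unital contraction preserves accretivity. -/
theorem IsUnitalMap.rePartGE_zero {A : Submodule ℂ (K →L[ℂ] K)} {T : A →ₗ[ℂ] (H →L[ℂ] H)}
    (hT : IsContractiveMap A T) (hU : IsUnitalMap A T) {a : A}
    (ha : RePartGE (a : K →L[ℂ] K) 0) : RePartGE (T a) 0 := by
  obtain ⟨h1, hT1⟩ := hU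
  refine RePartGE.of_forall_add (d := ‖a‖ ^ 2 / 2) fun t ht => ?_
  intro ξ
  -- Accretivity removes the first-order term. The same bound for `T a`, divided by `2t`, returns
  -- accretivity up to `t ‖a‖² / 2`.
  have hn : ‖(1 : K →L[ℂ] K) - (t : ℂ) • (a : K →L[ℂ] K)‖ ≤ Real.sqrt (1 + t ^ 2 * ‖a‖ ^ 2) := by
    refine ContinuousLinearMap.opNorm_le_bound _ (Real.sqrt_nonneg _) fun η => ?_
    refine le_of_sq_le_sq ?_ (by positivity)
    rw [norm_sq_one_sub_smul_apply, mul_pow, Real.sq_sqrt (by positivity)]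
    have h2 : ‖(a : K →L[ℂ] K) η‖ ^ 2 ≤ (‖a‖ * ‖η‖) ^ 2 := by
      gcongr; exact (a : K →L[ℂ] K).le_opNorm η
    have h3 := ha η
    have h4 : t ^ 2 * ‖(a : K →L[ℂ] K) η‖ ^ 2 ≤ t ^ 2 * (‖a‖ * ‖η‖) ^ 2 := by gcongr
    have h5 : 0 ≤ t * (inner ℂ ((a : K →L[ℂ] K) η) η).re := mul_nonneg ht.le (by linarith)
    nlinarith
  have hTn : ‖(1 : H →L[ℂ] H) - (t : ℂ) • T a‖ ≤ Real.sqrt (1 + t ^ 2 * ‖a‖ ^ 2) := by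
    have := hT (⟨1, h1⟩ - (t : ℂ) • a)
    rw [map_sub, map_smul, hT1] at this
    exact this.trans hn
  have h6 : ‖((1 : H →L[ℂ] H) - (t : ℂ) • T a) ξ‖ ^ 2 ≤ (Real.sqrt (1 + t ^ 2 * ‖a‖ ^ 2) * ‖ξ‖) ^ 2 := by
    gcongr
    exact ContinuousLinearMap.le_of_opNorm_le _ hTn ξ
  rw [norm_sq_one_sub_smul_apply, mul_pow, Real.sq_sqrt (by positivity)] at h6
  have h7 : 0 ≤ t ^ 2 * ‖T a ξ‖ ^ 2 := by positivity
  have h8 : 0 ≤ t * ((inner ℂ (T a ξ) ξ).re + ‖a‖ ^ 2 / 2 * t * ‖ξ‖ ^ 2) := by nlinarith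
  have := nonneg_of_mul_nonneg_right h8 ht
  linarith

end QuadraticForm

/-! ### Correcting almost accretive elements; transfer of real parts by `T`. -/

section RealPart

variable {K : Type*} [NormedAddCommGroup K] [InnerProductSpace ℂ K] [CompleteSpace K]
variable {H : Type*} [NormedAddCommGroup H] [InnerProductSpace ℂ H] [CompleteSpace H]

theorem IsApproxUnitalJordanOperatorAlgebra.exists_halfway {A : Submodule ℂ (K →L[ℂ] K)}
    (hA : IsApproxUnitalJordanOperatorAlgebra A) {y : K →L[ℂ] K} (hyA : y ∈ A) {ε : ℝ}
    (hε : 0 < ε) (hy : RePartGE y (-ε)) :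
    ∃ z ∈ A, ‖y - z‖ ≤ ε / 2 ∧ RePartGE z (-(3 / 4 * ε)) := by
  obtain ⟨l, hl, hu, hlim⟩ := hA.hasJordanCai
  have ht := tendsto_mul_of_jordan (u := fun u : A => (u : K →L[ℂ] K)) hA.jordanProd_mem
    (fun u => u.2) hu hlim hyA
  -- Chosen so that `norm_sq_adjoint_sub_le`, which loses a square root, gives `‖f* y ξ - y ξ‖ ≤
  -- (ε/4) ‖ξ‖`.
  set δ : ℝ := (ε / 4) ^ 2 / (2 * (‖y‖ + 1)) with hδ
  have hδ0 : 0 < δ := by positivity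
  obtain ⟨f, hf, h1, h2⟩ := (hu.and ((Metric.tendsto_nhds.1 ht.2 (ε / 4) (by positivity)).and
    (Metric.tendsto_nhds.1 ht.1 δ hδ0))).exists
  rw [dist_eq_norm] at h1 h2
  have hf' : ‖(f : K →L[ℂ] K)‖ ≤ 1 := hf
  refine ⟨y + ((ε / 2 : ℝ) : ℂ) • (f : K →L[ℂ] K), A.add_mem hyA (A.smul_mem _ f.2), ?_,
    hy.add_smul_of_almost_unit hε hf' h1.le fun ξ => ?_⟩
  · rw [sub_add_cancel_left, norm_neg, norm_smul, Complex.norm_real, Real.norm_of_nonneg (by positivity)]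
    exact mul_le_of_le_one_right (by positivity) hf'
  · have e : inner ℂ (y ξ) ((f : K →L[ℂ] K) ξ - ξ)
        = inner ℂ (ContinuousLinearMap.adjoint (f : K →L[ℂ] K) (y ξ) - y ξ) ξ := by
      rw [inner_sub_left, inner_sub_right, ContinuousLinearMap.adjoint_inner_left]
    rw [e]
    refine (norm_inner_le_norm _ _).trans ?_
    rw [sq, ← mul_assoc]
    gcongr
    refine le_of_sq_le_sq ?_ (by positivity)
    refine (norm_sq_adjoint_sub_le hf' (y ξ)).trans ?_
    have b1 : ‖(f : K →L[ℂ] K) (y ξ) - y ξ‖ ≤ δ * ‖ξ‖ :=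
      ((f : K →L[ℂ] K) * y - y).le_of_opNorm_le h2.le ξ
    have b2 : ‖y ξ‖ ≤ (‖y‖ + 1) * ‖ξ‖ := y.le_of_opNorm_le (by linarith) ξ
    calc _ ≤ 2 * ((δ * ‖ξ‖) * ((‖y‖ + 1) * ‖ξ‖)) := by gcongr
      _ = (ε / 4 * ‖ξ‖) ^ 2 := by rw [hδ]; field_simp

/-- In an approximately unital Jordan operator algebra, almost accretive elements are close to
accretive elements of the algebra. -/
theorem IsApproxUnitalJordanOperatorAlgebra.exists_accretive {A : Submodule ℂ (K →L[ℂ] K)}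
    (hA : IsApproxUnitalJordanOperatorAlgebra A) {y : K →L[ℂ] K} (hyA : y ∈ A) {ε : ℝ}
    (hε : 0 < ε) (hy : RePartGE y (-ε)) :
    ∃ z ∈ A, ‖z - y‖ ≤ 2 * ε ∧ RePartGE z 0 := by
  -- Each correction cuts the defect to 3/4 of its size and moves by at most half the defect, so the
  -- total displacement is at most `(ε/2) / (1 - 3/4) = 2ε`.
  let S (n : ℕ) := {z : K →L[ℂ] K // z ∈ A ∧ RePartGE z (-(ε * (3 / 4) ^ n))}
  have step : ∀ n, ∀ z : S n, ∃ w : S (n + 1), ‖z.1 - w.1‖ ≤ ε / 2 * (3 / 4) ^ n := by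
    rintro n ⟨z, hzA, hz⟩
    obtain ⟨w, hwA, hw1, hw2⟩ := hA.exists_halfway hzA (by positivity) hz
    exact ⟨⟨w, hwA, hw2.mono (by rw [pow_succ]; linarith)⟩, hw1.trans (by linarith)⟩
  choose next hnext using step
  let s : ∀ n, S n := fun n => Nat.rec ⟨y, hyA, by simpa using hy⟩ (fun n z => next n z) n
  have hdist : ∀ n, dist (s n).1 (s (n + 1)).1 ≤ ε / 2 * (3 / 4) ^ n := by
    intro n; rw [dist_eq_norm]; exact hnext n (s n)
  obtain ⟨z, hz⟩ := cauchySeq_tendsto_of_complete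
    (cauchySeq_of_le_geometric (3 / 4) (ε / 2) (by norm_num) hdist)
  refine ⟨z, hA.isClosed.mem_of_tendsto hz (Eventually.of_forall fun n => (s n).2.1), ?_,
    RePartGE.of_tendsto hz ?_ fun n => (s n).2.2⟩
  · have := dist_le_of_le_geometric_of_tendsto₀ (3 / 4) (ε / 2) (by norm_num) hdist hz
    rw [dist_comm, dist_eq_norm] at this
    refine this.trans (le_of_eq ?_)
    ring
  · have := ((tendsto_pow_atTop_nhds_zero_of_lt_one (r := (3 / 4 : ℝ)) (by norm_num)
      (by norm_num)).const_mul ε).neg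
    simpa using this

/-- Both kinds of maps considered here preserve lower bounds of real parts, up to a factor. -/
theorem rePartGE_map {A : Submodule ℂ (K →L[ℂ] K)} {T : A →ₗ[ℂ] (H →L[ℂ] H)}
    (hT : IsContractiveMap A T)
    (hAT : IsUnitalMap A T ∨ (IsApproxUnitalJordanOperatorAlgebra A ∧ IsRealPositiveMap A T))
    (a : A) {ε : ℝ} (hε : 0 ≤ ε) (ha : RePartGE (a : K →L[ℂ] K) (-ε)) :
    RePartGE (T a) (-(2 * ε)) := by
  rcases hAT with hU | ⟨hA, hP⟩
  · obtain ⟨h1, hT1⟩ := id hU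
    have := hU.rePartGE_zero hT (a := a + (ε : ℂ) • ⟨1, h1⟩) fun η => by
      have := ha η
      rw [Submodule.coe_add, Submodule.coe_smul, re_inner_add_smul_one_apply]
      linarith
    intro ξ
    have h2 := this ξ
    rw [map_add, map_smul, hT1, re_inner_add_smul_one_apply] at h2
    have : 0 ≤ ε * ‖ξ‖ ^ 2 := by positivity
    linarith
  -- The correction needs a strictly positive defect, so `ε + δ` is used and `δ` tends to 0.
  · refine RePartGE.of_forall_add (d := 2) fun δ hδ => ?_
    obtain ⟨z, hzA, hz1, hz2⟩ := hA.exists_accretive (ε := ε + δ) a.2 (by positivity)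
      (ha.mono (by linarith))
    have h3 := (isRealPositive_iff _).1 (hP ⟨z, hzA⟩ ((isRealPositive_iff _).2 hz2))
    have h4 : ‖T ⟨z, hzA⟩ - T a‖ ≤ 2 * (ε + δ) := by
      rw [← map_sub]
      exact (hT _).trans hz1
    exact (h3.of_norm_sub_le h4).mono (by linarith)

end RealPart

/-- First order cannot be dominated by second order: take `c` to be `t` times the conjugate of `z`,
divide by `t`, and let `t` tend to 0. -/
theorem eq_zero_of_forall_re_mul_le {z : ℂ} {M : ℝ}
    (h : ∀ c : ℂ, (c * z).re ≤ M * ‖c‖ ^ 2) : z = 0 := by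
  have key : ∀ t > 0, ‖z‖ ^ 2 ≤ t * (M * ‖z‖ ^ 2) := by
    intro t ht
    have := h (t * starRingEnd ℂ z)
    rw [mul_assoc, mul_comm (starRingEnd ℂ z), Complex.mul_conj, ← Complex.ofReal_mul,
      Complex.ofReal_re, Complex.normSq_eq_norm_sq, norm_mul, Complex.norm_real,
      Real.norm_of_nonneg ht.le, Complex.norm_conj] at this
    have h2 : t * ‖z‖ ^ 2 ≤ t * (t * (M * ‖z‖ ^ 2)) := by nlinarith
    exact le_of_mul_le_mul_left h2 ht
  have ht : Tendsto (fun t : ℝ => t * (M * ‖z‖ ^ 2)) (𝓝[>] 0) (𝓝 (0 * (M * ‖z‖ ^ 2))) :=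
    (Continuous.tendsto (by fun_prop) 0).mono_left nhdsWithin_le_nhds
  have := ge_of_tendsto ht (eventually_nhdsWithin_of_forall fun t ht => key t ht)
  rw [zero_mul] at this
  have : ‖z‖ ^ 2 = 0 := le_antisymm this (sq_nonneg _)
  simpa using this

theorem eq_zero_of_forall_nonneg_add_mul {C m : ℝ} (h : ∀ s : ℝ, 0 ≤ C + s * m) : m = 0 := by
  by_contra hm
  have := h (-(C + 1) / m)
  rw [div_mul_cancel₀ _ hm] at this
  linarith

/-! ### Operators relative to a projection `q`. -/

section Projection

variable {H : Type*} [NormedAddCommGroup H] [InnerProductSpace ℂ H] [CompleteSpace H]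

theorem IsStarProjection.inner_apply_left {q : H →L[ℂ] H} (hq : IsStarProjection q) (x y : H) :
    inner ℂ (q x) y = inner ℂ x (q y) := by
  rw [← ContinuousLinearMap.adjoint_inner_left, ← ContinuousLinearMap.star_eq_adjoint,
    hq.isSelfAdjoint.star_eq]

theorem IsStarProjection.apply_apply {q : H →L[ℂ] H} (hq : IsStarProjection q) (x : H) :
    q (q x) = q x := congrArg (fun f : H →L[ℂ] H => f x) hq.isIdempotentElem.eq

theorem IsStarProjection.norm_sq_add {q : H →L[ℂ] H} (hq : IsStarProjection q) (x : H) :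
    ‖q x‖ ^ 2 + ‖x - q x‖ ^ 2 = ‖x‖ ^ 2 := by
  have h0 : inner ℂ (q x) (x - q x) = 0 := by
    rw [hq.inner_apply_left, map_sub, hq.apply_apply, sub_self, inner_zero_right]
  have := norm_add_sq_eq_norm_sq_add_norm_sq_of_inner_eq_zero (𝕜 := ℂ) _ _ h0
  rw [add_sub_cancel] at this
  simp only [← sq] at this
  exact this.symm

theorem IsStarProjection.re_inner_apply_self {q : H →L[ℂ] H} (hq : IsStarProjection q) (x : H) :
    (inner ℂ (q x) x).re = ‖q x‖ ^ 2 := by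
  rw [← hq.apply_apply, hq.inner_apply_left, hq.apply_apply]
  simpa using inner_self_eq_norm_sq (𝕜 := ℂ) (q x)

theorem IsStarProjection.compress_eq_zero {q D : H →L[ℂ] H} (hq : IsStarProjection q)
    (h : ∀ ξ, q ξ = ξ → inner ℂ ξ (D ξ) = 0) : q * D * q = 0 := by
  have : ((q * D * q : H →L[ℂ] H) : H →ₗ[ℂ] H) = 0 := by
    rw [← inner_map_self_eq_zero]
    intro x
    rw [← inner_conj_symm]
    change starRingEnd ℂ (inner ℂ x (q (D (q x)))) = 0
    rw [← hq.inner_apply_left, h _ (hq.apply_apply x), map_zero]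
  exact ContinuousLinearMap.coe_injective this

/-- `‖q + D‖ ≤ 1` with a projection `q` and `q D q = 0` forces `D q = 0`. -/
theorem IsStarProjection.mul_eq_zero_of_norm_add_le {q D : H →L[ℂ] H} (hq : IsStarProjection q)
    (hD : q * D * q = 0) (hn : ‖q + D‖ ≤ 1) : D * q = 0 := by
  ext x
  have h0 : inner ℂ (q x) (D (q x)) = 0 := by
    rw [hq.inner_apply_left]
    have : q (D (q x)) = 0 := congrArg (fun f : H →L[ℂ] H => f x) hD
    rw [this, inner_zero_right]
  have h1 := norm_add_sq_eq_norm_sq_add_norm_sq_of_inner_eq_zero (𝕜 := ℂ) _ _ h0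
  have h2 : ‖q x + D (q x)‖ ≤ ‖q x‖ := by
    have := (q + D).le_of_opNorm_le hn (q x)
    rwa [add_apply, hq.apply_apply, one_mul] at this
  have h3 : ‖D (q x)‖ = 0 := by nlinarith [norm_nonneg (D (q x)), norm_nonneg (q x + D (q x))]
  simpa using h3

/-- If `c q + λ X` is accretive for all unimodular `λ` and the corner of `X` at `1 - q` vanishes,
then `X = q X q`. -/
theorem IsStarProjection.eq_compress_of_rePartGE {q X : H →L[ℂ] H} (hq : IsStarProjection q)
    (hX : (1 - q) * X * (1 - q) = 0) {c : ℝ}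
    (h : ∀ lam : ℂ, ‖lam‖ = 1 → RePartGE ((c : ℂ) • q + lam • X) 0) : X = q * X * q := by
  have key : ∀ ξ η : H, q ξ = 0 → q η = η → inner ℂ (X ξ) η = 0 ∧ inner ℂ (X η) ξ = 0 := by
    intro ξ η hξ hη
    have hξξ : inner ℂ (X ξ) ξ = 0 := by
      have h1 : ((1 - q) * X * (1 - q)) ξ = 0 := by rw [hX]; rfl
      have h2 : X ξ = q (X ξ) := by
        simpa [hξ, sub_eq_zero] using h1
      rw [h2, hq.inner_apply_left, hξ, inner_zero_right]
    -- Since `⟨X ξ, ξ⟩ = 0`, the form at `t s ξ + η` is affine in real `t`. Being nonnegative for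
    -- all `t`, it has zero slope; `lam` and `s` in `{1, i}` then determine both cross terms.
    have form : ∀ lam s : ℂ, ‖lam‖ = 1 →
        (starRingEnd ℂ lam * (starRingEnd ℂ s * inner ℂ (X ξ) η + s * inner ℂ (X η) ξ)).re = 0 := by
      intro lam s hlam
      refine eq_zero_of_forall_nonneg_add_mul
        (C := c * ‖η‖ ^ 2 + (starRingEnd ℂ lam * inner ℂ (X η) η).re) fun t => ?_
      have := h lam hlam (((t : ℂ) * s) • ξ + η)
      have e : inner ℂ (((c : ℂ) • q + lam • X) (((t : ℂ) * s) • ξ + η)) (((t : ℂ) * s) • ξ + η)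
          = c * inner ℂ η η + starRingEnd ℂ lam * inner ℂ (X η) η
            + t * (starRingEnd ℂ lam *
              (starRingEnd ℂ s * inner ℂ (X ξ) η + s * inner ℂ (X η) ξ)) := by
        have hηξ : inner ℂ η ξ = 0 := by rw [← hη, hq.inner_apply_left, hξ, inner_zero_right]
        simp only [add_apply, smul_apply, map_add, map_smul, hξ, hη, smul_zero, zero_add,
          inner_add_left, inner_add_right, inner_smul_left, inner_smul_right, hξξ, hηξ, map_mul,
          Complex.conj_ofReal]
        ring
      have eη : (inner ℂ η η).re = ‖η‖ ^ 2 := by simpa using inner_self_eq_norm_sq (𝕜 := ℂ) η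
      rw [e, Complex.add_re, Complex.add_re, Complex.re_ofReal_mul, Complex.re_ofReal_mul, eη,
        zero_mul] at this
      exact this
    have f1 := form 1 1 (by simp)
    have f2 := form 1 Complex.I (by simp)
    have f3 := form Complex.I 1 (by simp)
    have f4 := form Complex.I Complex.I (by simp)
    simp at f1 f2 f3 f4
    constructor <;> apply Complex.ext <;> simp <;> linarith
  have hr : ∀ x, q (x - q x) = 0 := fun x => by rw [map_sub, hq.apply_apply, sub_self]
  have a1 : X * q = q * X * q := by
    ext x
    refine ext_inner_right ℂ fun w => ?_
    have := (key (w - q w) (q x) (hr w) (hq.apply_apply x)).2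
    rw [inner_sub_right, sub_eq_zero] at this
    change inner ℂ (X (q x)) w = inner ℂ (q (X (q x))) w
    rw [this, hq.inner_apply_left]
  have a2 : q * X * (1 - q) = 0 := by
    ext x
    refine ext_inner_right ℂ fun w => ?_
    have := (key (x - q x) (q w) (hr x) (hq.apply_apply w)).1
    change inner ℂ (q (X (x - q x))) w = inner ℂ (0 : H) w
    rw [hq.inner_apply_left, this, inner_zero_left]
  calc X = X * q + q * X * (1 - q) + (1 - q) * X * (1 - q) := by noncomm_ring
    _ = q * X * q := by rw [hX, a2, a1]; simp

end Projection

/-! ### Peirce pieces under `T`. -/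

section Compression

variable {K : Type*} [NormedAddCommGroup K] [InnerProductSpace ℂ K] [CompleteSpace K]
variable {H : Type*} [NormedAddCommGroup H] [InnerProductSpace ℂ H] [CompleteSpace H]

/-- Because `ebe = 0`, the cross term sees only `ξ - e ξ`; AM-GM absorbs it into `‖ξ - e ξ‖²` at
second-order cost in `c`. -/
theorem IsStarProjection.norm_add_smul_le {e b : K →L[ℂ] K} (he : IsStarProjection e)
    (hb : e * b * e = 0) (c : ℂ) : ‖e + c • b‖ ≤ Real.sqrt (1 + 2 * ‖c‖ ^ 2 * ‖b‖ ^ 2) := by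
  refine ContinuousLinearMap.opNorm_le_bound _ (Real.sqrt_nonneg _) fun ξ => ?_
  refine le_of_sq_le_sq ?_ (by positivity)
  rw [mul_pow, Real.sq_sqrt (by positivity), add_apply, smul_apply, @norm_add_sq ℂ, norm_smul,
    inner_smul_right]
  have h1 : inner ℂ (e ξ) (b ξ) = inner ℂ (e ξ) (b (ξ - e ξ)) := by
    have : e (b (e ξ)) = 0 := congrArg (fun f : K →L[ℂ] K => f ξ) hb
    rw [map_sub, inner_sub_right, he.inner_apply_left _ (b (e ξ)), this, inner_zero_right, sub_zero]
  have h2 : (c * inner ℂ (e ξ) (b ξ)).re ≤ ‖c‖ * (‖e ξ‖ * (‖b‖ * ‖ξ - e ξ‖)) := by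
    refine (Complex.re_le_norm _).trans ?_
    rw [norm_mul, h1]
    gcongr
    exact (norm_inner_le_norm _ _).trans (by gcongr; exact b.le_opNorm _)
  have h3 := he.norm_sq_add ξ
  have h4 : (‖c‖ * ‖b ξ‖) ^ 2 ≤ (‖c‖ * (‖b‖ * ‖ξ‖)) ^ 2 := by
    gcongr; exact b.le_opNorm ξ
  have h5 : (‖c‖ * ‖b‖) ^ 2 * ‖e ξ‖ ^ 2 ≤ (‖c‖ * ‖b‖) ^ 2 * ‖ξ‖ ^ 2 := by
    refine mul_le_mul_of_nonneg_left ?_ (sq_nonneg _)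
    nlinarith [sq_nonneg ‖ξ - e ξ‖]
  simp only [RCLike.re_to_complex]
  nlinarith [sq_nonneg (‖c‖ * ‖b‖ * ‖e ξ‖ - ‖ξ - e ξ‖)]

theorem IsStarProjection.norm_add_le_one {e d : K →L[ℂ] K} (he : IsStarProjection e)
    (h1 : e * d = 0) (h2 : d * e = 0) (hd : ‖d‖ ≤ 1) : ‖e + d‖ ≤ 1 := by
  refine ContinuousLinearMap.opNorm_le_bound _ zero_le_one fun ξ => ?_
  rw [one_mul]
  refine le_of_sq_le_sq ?_ (norm_nonneg _)
  have e1 : d ξ = d (ξ - e ξ) := by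
    have : d (e ξ) = 0 := congrArg (fun f : K →L[ℂ] K => f ξ) h2
    rw [map_sub, this, sub_zero]
  have e2 : inner ℂ (e ξ) (d ξ) = 0 := by
    have : e (d ξ) = 0 := congrArg (fun f : K →L[ℂ] K => f ξ) h1
    rw [he.inner_apply_left, this, inner_zero_right]
  have h3 := norm_add_sq_eq_norm_sq_add_norm_sq_of_inner_eq_zero (𝕜 := ℂ) _ _ e2
  have h4 : ‖d ξ‖ ≤ ‖ξ - e ξ‖ := by
    rw [e1]; simpa using d.le_of_opNorm_le hd (ξ - e ξ)
  rw [add_apply]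
  nlinarith [he.norm_sq_add ξ, norm_nonneg (d ξ)]

/-- The summand `‖a‖ e` dominates the `e`-corner of `a`; the summand `e` completes the square with
the off-diagonal terms, at cost `‖a‖² ‖ξ - e ξ‖²`. -/
theorem IsStarProjection.rePartGE_add {e a : K →L[ℂ] K} (he : IsStarProjection e)
    (ha : (1 - e) * a * (1 - e) = 0) : RePartGE (((1 + ‖a‖ : ℝ) : ℂ) • e + a) (-(‖a‖ ^ 2)) := by
  intro ξ
  rw [add_apply, smul_apply, inner_add_left, inner_smul_left, Complex.conj_ofReal, Complex.add_re,
    Complex.re_ofReal_mul, he.re_inner_apply_self]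
  have h1 : inner ℂ (a ξ) ξ = inner ℂ (a (e ξ)) ξ + inner ℂ (a (ξ - e ξ)) (e ξ) := by
    have h0 : a (ξ - e ξ) - e (a (ξ - e ξ)) = 0 :=
      congrArg (fun f : K →L[ℂ] K => f ξ) ha
    rw [← he.inner_apply_left (a (ξ - e ξ)), ← sub_eq_zero.1 h0, ← inner_add_left, ← map_add,
      add_sub_cancel]
  have n1 : ‖inner ℂ (a (e ξ)) ξ‖ ≤ ‖a‖ * ‖e ξ‖ * (‖e ξ‖ + ‖ξ - e ξ‖) := by
    refine (norm_inner_le_norm _ _).trans ?_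
    gcongr
    · exact a.le_opNorm _
    · simpa using norm_add_le (e ξ) (ξ - e ξ)
  have n2 : ‖inner ℂ (a (ξ - e ξ)) (e ξ)‖ ≤ ‖a‖ * ‖ξ - e ξ‖ * ‖e ξ‖ := by
    refine (norm_inner_le_norm _ _).trans ?_
    gcongr
    exact a.le_opNorm _
  have r1 := (abs_le.1 ((Complex.abs_re_le_norm _).trans n1)).1
  have r2 := (abs_le.1 ((Complex.abs_re_le_norm _).trans n2)).1
  rw [h1, Complex.add_re]
  have h3 := he.norm_sq_add ξ
  have h5 : ‖a‖ ^ 2 * ‖ξ - e ξ‖ ^ 2 ≤ ‖a‖ ^ 2 * ‖ξ‖ ^ 2 := by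
    refine mul_le_mul_of_nonneg_left ?_ (sq_nonneg _)
    nlinarith [sq_nonneg ‖e ξ‖]
  nlinarith [sq_nonneg (‖e ξ‖ - ‖a‖ * ‖ξ - e ξ‖)]

theorem IsStarProjection.rePartGE_zero_of_compress {e x : K →L[ℂ] K} (he : IsStarProjection e)
    (hx : e * x * e = x) : RePartGE ((‖x‖ : ℂ) • e + x) 0 := by
  intro ξ
  rw [add_apply, smul_apply, inner_add_left, inner_smul_left, Complex.conj_ofReal, Complex.add_re,
    Complex.re_ofReal_mul, he.re_inner_apply_self]
  have h1 : inner ℂ (x ξ) ξ = inner ℂ (x (e ξ)) (e ξ) := by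
    rw [← he.inner_apply_left]
    change _ = inner ℂ ((e * x * e) ξ) ξ
    rw [hx]
  have n1 : ‖inner ℂ (x (e ξ)) (e ξ)‖ ≤ ‖x‖ * ‖e ξ‖ * ‖e ξ‖ := by
    refine (norm_inner_le_norm _ _).trans ?_
    gcongr
    exact x.le_opNorm _
  have r1 := (abs_le.1 ((Complex.abs_re_le_norm _).trans n1)).1
  rw [h1]
  nlinarith

variable {A : Submodule ℂ (K →L[ℂ] K)} {T : A →ₗ[ℂ] (H →L[ℂ] H)} {e : A}

theorem IsContractiveMap.compress_eq_zero (hT : IsContractiveMap A T)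
    (he : IsStarProjection (e : K →L[ℂ] K)) (hq : IsStarProjection (T e)) {b : A}
    (hb : (e : K →L[ℂ] K) * b * e = 0) : T e * T b * T e = 0 := by
  refine hq.compress_eq_zero fun η hη => ?_
  refine eq_zero_of_forall_re_mul_le (M := ‖b‖ ^ 2 * ‖η‖ ^ 2) fun c => ?_
  have h1 : ‖T e + c • T b‖ ≤ Real.sqrt (1 + 2 * ‖c‖ ^ 2 * ‖b‖ ^ 2) := by
    rw [← map_smul, ← map_add]
    exact (hT _).trans (he.norm_add_smul_le hb c)
  have h2 : ‖(T e + c • T b) η‖ ^ 2 ≤ (Real.sqrt (1 + 2 * ‖c‖ ^ 2 * ‖b‖ ^ 2) * ‖η‖) ^ 2 := by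
    gcongr
    exact ContinuousLinearMap.le_of_opNorm_le _ h1 η
  rw [mul_pow, Real.sq_sqrt (by positivity), add_apply, smul_apply, hη, @norm_add_sq ℂ,
    inner_smul_right] at h2
  simp only [RCLike.re_to_complex] at h2
  nlinarith [sq_nonneg ‖c • T b η‖]

theorem IsContractiveMap.map_mul_eq_zero (hT : IsContractiveMap A T)
    (he : IsStarProjection (e : K →L[ℂ] K)) (hq : IsStarProjection (T e)) {d : A}
    (h1 : (e : K →L[ℂ] K) * d = 0) (h2 : (d : K →L[ℂ] K) * e = 0) :
    T e * T d = 0 ∧ T d * T e = 0 := by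
  have h0 : T e * T d * T e = 0 := hT.compress_eq_zero he hq (by rw [h1, zero_mul])
  set t : ℝ := (‖d‖ + 1)⁻¹ with ht
  have ht0 : 0 < t := by positivity
  have hn : ‖T e + (t : ℂ) • T d‖ ≤ 1 := by
    rw [← map_smul, ← map_add]
    refine (hT _).trans (he.norm_add_le_one ?_ ?_ ?_)
    · rw [Submodule.coe_smul, mul_smul_comm, h1, smul_zero]
    · rw [Submodule.coe_smul, smul_mul_assoc, h2, smul_zero]
    · rw [Submodule.coe_smul, norm_smul, Complex.norm_real, Real.norm_of_nonneg ht0.le, ht,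
        inv_mul_le_iff₀ (by positivity)]
      change ‖d‖ ≤ _
      linarith
  have htc : (t : ℂ) ≠ 0 := by exact_mod_cast ht0.ne'
  constructor
  -- The lemma controls only right multiplication by `q`; the left side follows by taking adjoints.
  · have := hq.mul_eq_zero_of_norm_add_le (D := star ((t : ℂ) • T d)) ?_ ?_
    · have := congrArg star this
      rw [star_mul, star_star, star_zero, hq.isSelfAdjoint.star_eq, mul_smul_comm] at this
      exact (smul_eq_zero.1 this).resolve_left htc
    · have := congrArg star h0
      rw [star_mul, star_mul, star_zero, hq.isSelfAdjoint.star_eq, ← mul_assoc] at this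
      rw [star_smul, mul_smul_comm, smul_mul_assoc, this, smul_zero]
    · rw [← norm_star, star_add, star_star, hq.isSelfAdjoint.star_eq]
      exact hn
  · have := hq.mul_eq_zero_of_norm_add_le (D := (t : ℂ) • T d)
      (by rw [mul_smul_comm, smul_mul_assoc, h0, smul_zero]) hn
    rw [smul_mul_assoc] at this
    exact (smul_eq_zero.1 this).resolve_left htc

/-- On the kernel of `q` the multiple of `e` becomes invisible after `T`, leaving a first-order term
bounded by a second-order one. The factor 2 in `hR` is therefore harmless. -/
theorem compress_compl_eq_zero
    (hR : ∀ (a : A) {ε : ℝ}, 0 ≤ ε → RePartGE (a : K →L[ℂ] K) (-ε) → RePartGE (T a) (-(2 * ε)))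
    (he : IsStarProjection (e : K →L[ℂ] K)) (hq : IsStarProjection (T e)) {a : A}
    (ha : (1 - (e : K →L[ℂ] K)) * a * (1 - e) = 0) : (1 - T e) * T a * (1 - T e) = 0 := by
  refine hq.one_sub.compress_eq_zero fun ξ hξ => ?_
  have hqξ : T e ξ = 0 := by
    rw [sub_apply, one_apply_eq_self, sub_eq_self] at hξ
    exact hξ
  refine eq_zero_of_forall_re_mul_le (M := 2 * ‖a‖ ^ 2 * ‖ξ‖ ^ 2) fun c => ?_
  have h1 := he.rePartGE_add (a := (((-c) • a : A) : K →L[ℂ] K)) (by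
    rw [Submodule.coe_smul, mul_smul_comm, smul_mul_assoc, ha, smul_zero])
  have h2 := hR (((1 + ‖(-c) • a‖ : ℝ) : ℂ) • e + (-c) • a) (sq_nonneg _) h1 ξ
  have hn : ‖(((-c) • a : A) : K →L[ℂ] K)‖ = ‖c‖ * ‖a‖ := by
    rw [Submodule.coe_smul, norm_smul, norm_neg]; rfl
  have hre : (inner ℂ (((-c) • T a) ξ) ξ).re = -(c * inner ℂ ξ (T a ξ)).re := by
    rw [← inner_conj_symm, Complex.conj_re, smul_apply, inner_smul_right]
    simp
  rw [map_add, map_smul, map_smul, hn, add_apply, smul_apply, hqξ, smul_zero, zero_add, hre] at h2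
  nlinarith

theorem map_eq_compress
    (hR : ∀ (a : A) {ε : ℝ}, 0 ≤ ε → RePartGE (a : K →L[ℂ] K) (-ε) → RePartGE (T a) (-(2 * ε)))
    (he : IsStarProjection (e : K →L[ℂ] K)) (hq : IsStarProjection (T e)) {x : A}
    (hx : (e : K →L[ℂ] K) * x * e = x) : T x = T e * T x * T e := by
  refine hq.eq_compress_of_rePartGE (c := ‖x‖) (compress_compl_eq_zero hR he hq ?_)
    fun lam hlam => ?_
  · rw [← hx, ← mul_assoc, ← mul_assoc, sub_mul, one_mul, he.isIdempotentElem.eq, sub_self]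
    simp
  · have h1 := he.rePartGE_zero_of_compress (x := ((lam • x : A) : K →L[ℂ] K)) (by
      rw [Submodule.coe_smul, mul_smul_comm, smul_mul_assoc, hx])
    have hn : ‖((lam • x : A) : K →L[ℂ] K)‖ = ‖x‖ := by
      rw [Submodule.coe_smul, norm_smul, hlam, one_mul]; rfl
    rw [hn] at h1
    have h2 := hR ((‖x‖ : ℂ) • e + lam • x) le_rfl (by rw [neg_zero]; exact h1)
    rw [mul_zero, neg_zero, map_add, map_smul, map_smul] at h2
    exact h2

end Compression

/-! ### Assembly of the Peirce decomposition. -/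

theorem jordanProd_comm {R : Type*} [Ring R] [Algebra ℂ R] (x y : R) :
    jordanProd x y = jordanProd y x := by
  rw [jordanProd, jordanProd, add_comm]

theorem IsIdempotentElem.mul_mul_eq_jordanProd {R : Type*} [Ring R] [Algebra ℂ R] {e : R}
    (he : IsIdempotentElem e) (a : R) :
    e * a * e = (2 : ℂ) • jordanProd e (jordanProd e a) - jordanProd e a := by
  have h1 : (2 : ℂ) • jordanProd e (jordanProd e a)
      = (1 / 2 : ℂ) • (e * (e * a + a * e) + (e * a + a * e) * e) := by
    rw [two_smul_jordanProd, jordanProd, mul_smul_comm, smul_mul_assoc, smul_add]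
  have h2 : e * (e * a + a * e) + (e * a + a * e) * e
      = (e * a + a * e) + (2 : ℂ) • (e * a * e) := by
    rw [mul_add, add_mul, ← mul_assoc, he.eq, mul_assoc a e e, he.eq, two_smul, mul_assoc e a e]
    abel
  rw [h1, h2, smul_add, smul_smul, jordanProd]
  norm_num

theorem lemma3p9
    {K : Type*} [NormedAddCommGroup K] [InnerProductSpace ℂ K] [CompleteSpace K]
    {H : Type*} [NormedAddCommGroup H] [InnerProductSpace ℂ H] [CompleteSpace H]
    (A : Submodule ℂ (K →L[ℂ] K)) (T : A →ₗ[ℂ] (H →L[ℂ] H))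
    (hT : IsContractiveMap A T)
    (hAT : IsUnitalMap A T ∨ (IsApproxUnitalJordanOperatorAlgebra A ∧ IsRealPositiveMap A T))
    (e : K →L[ℂ] K) (he : IsStarProjection e) (heA : e ∈ A)
    (heJ : ∀ a ∈ A, jordanProd e a ∈ A)
    (q : H →L[ℂ] H) (hqe : T ⟨e, heA⟩ = q) (hq : IsStarProjection q) :
    ∀ a : A,
      (∃ h : e * (a : K →L[ℂ] K) * e ∈ A, T ⟨e * (a : K →L[ℂ] K) * e, h⟩ = q * T a * q) ∧
      (∃ h : jordanProd (a : K →L[ℂ] K) e ∈ A,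
        T ⟨jordanProd (a : K →L[ℂ] K) e, h⟩ = jordanProd (T a) q) := by
  intro a
  have hR := fun (a : A) {ε : ℝ} => rePartGE_map hT hAT a (ε := ε)
  have hee := he.isIdempotentElem
  have hj : jordanProd (a : K →L[ℂ] K) e ∈ A := by
    rw [jordanProd_comm]; exact heJ a a.2
  have hx : e * (a : K →L[ℂ] K) * e ∈ A := by
    rw [hee.mul_mul_eq_jordanProd]
    exact A.sub_mem (A.smul_mem _ (heJ _ (heJ _ a.2))) (heJ _ a.2)
  obtain ⟨E, hE⟩ : ∃ E : A, E = ⟨e, heA⟩ := ⟨_, rfl⟩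
  obtain ⟨x, hxe⟩ : ∃ x : A, x = ⟨_, hx⟩ := ⟨_, rfl⟩
  obtain ⟨j, hje⟩ : ∃ j : A, j = ⟨_, hj⟩ := ⟨_, rfl⟩
  have cE : (E : K →L[ℂ] K) = e := by rw [hE]
  have cx : (x : K →L[ℂ] K) = e * a * e := by rw [hxe]
  have cj : (j : K →L[ℂ] K) = jordanProd (a : K →L[ℂ] K) e := by rw [hje]
  have hTE : T E = q := by rw [hE, hqe]
  have heE : IsStarProjection (E : K →L[ℂ] K) := by rwa [cE]
  have hqE : IsStarProjection (T E) := by rwa [hTE]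
  have c2 : (((2 : ℂ) • j : A) : K →L[ℂ] K) = a * e + e * a := by
    rw [Submodule.coe_smul, cj, two_smul_jordanProd]
  have l1 : ∀ z : K →L[ℂ] K, e * (e * z) = e * z := fun z => by rw [← mul_assoc, hee.eq]
  have l2 : e * e = e := hee.eq
  have hTx : T x = q * T a * q := by
    have h1 := map_eq_compress hR heE hqE (x := x) (by
      rw [cE, cx]; simp only [mul_assoc, l1, l2])
    have h2 := hT.compress_eq_zero heE hqE (b := a - x) (by
      rw [Submodule.coe_sub, cE, cx]
      simp only [mul_sub, sub_mul, mul_assoc, l1, l2, sub_self])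
    rw [map_sub, mul_sub, sub_mul, ← h1, hTE, sub_eq_zero] at h2
    exact h2.symm
  -- This is `(1-e)a(1-e)`, written with elements known to lie in `A`.
  obtain ⟨d, hd⟩ : ∃ d : A, d = a - (2 : ℂ) • j + x := ⟨_, rfl⟩
  have cd : (d : K →L[ℂ] K) = a - (a * e + e * a) + e * a * e := by
    rw [hd, Submodule.coe_add, Submodule.coe_sub, c2, cx]
  obtain ⟨hd1, hd2⟩ := hT.map_mul_eq_zero heE hqE (d := d)
    (by rw [cE, cd]; simp only [mul_add, mul_sub, mul_assoc, l1]; abel)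
    (by rw [cE, cd]; simp only [add_mul, sub_mul, mul_assoc, l2]; abel)
  -- The off-diagonal part: both of its diagonal corners vanish, and hence so do those of `T b`.
  obtain ⟨b, hb⟩ : ∃ b : A, b = (2 : ℂ) • j - (2 : ℂ) • x := ⟨_, rfl⟩
  have cb : (b : K →L[ℂ] K) = a * e + e * a - (2 : ℂ) • (e * a * e) := by
    rw [hb, Submodule.coe_sub, c2, Submodule.coe_smul, cx]
  have hb1 := hT.compress_eq_zero heE hqE (b := b) (by
    rw [cE, cb]
    simp only [mul_sub, sub_mul, mul_add, add_mul, two_smul, mul_assoc, l1, l2]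
    abel)
  have hb2 := compress_compl_eq_zero hR heE hqE (a := b) (by
    rw [cE, cb]
    simp only [mul_sub, sub_mul, mul_add, add_mul, two_smul, mul_assoc, l1, l2, one_mul, mul_one]
    abel)
  rw [hTE] at hd1 hd2 hb1 hb2
  have hb3 : T b = q * T b + T b * q := by
    have : (1 - q) * T b * (1 - q) = T b - (q * T b + T b * q) + q * T b * q := by noncomm_ring
    rw [this, hb1, add_zero, sub_eq_zero] at hb2
    exact hb2
  have m1 : q * (T x) = T x := by
    rw [hTx, ← mul_assoc, ← mul_assoc, hq.isIdempotentElem.eq]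
  have m2 : T x * q = T x := by
    rw [hTx, mul_assoc, hq.isIdempotentElem.eq]
  have ha : a = x + b + d := by rw [hb, hd, two_smul ℂ x]; abel
  have hj2 : j = x + (1 / 2 : ℂ) • b := by
    rw [hb, smul_sub, smul_smul, smul_smul]; norm_num
  refine ⟨⟨hx, hxe ▸ hTx⟩, hj, ?_⟩
  rw [← hje, hj2, map_add, map_smul]
  have hTa : T a * q + q * T a = (2 : ℂ) • T x + T b := by
    conv_lhs => rw [ha]
    rw [map_add, map_add, add_mul, add_mul, mul_add, mul_add, hd1, hd2, m1, m2, two_smul]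
    nth_rewrite 3 [hb3]
    abel
  rw [jordanProd, hTa, smul_add, smul_smul]
  norm_num
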